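/- Let $d\ge 1$ and $0\le s\le\lfloor d/2\rfloor$ be integers. A real polynomial of degree $d$ has signature $s$ if it has exactly $s$ pairs of complex conjugate non-real roots, counted with multiplicity. For real $B\ge 1$ let $D_d(s,B)$ be the number of polynomials $p_dX^d+\dots+p_0\in\mathbb Z[X]$ with $p_d\ne 0$, $|p_i|\le B$ for $0\le i\le d$, and signature $s$. Let $\mathcal H_d(s)$ be the set of vectors $(p_0,\dots,p_d)\in[-1,1]^{d+1}$ with $p_d\neq 0$ such that the polynomial $p_dX^d+\dots+p_0$ has signature $s$. Then $\mathcal H_d(s)$ is Lebesgue measurable, and, with $\lambda_{d+1}$ the Lebesgue measure on $\mathbb R^{d+1}$, $$D_d(s,B)=\lambda_{d+1}(\mathcal H_d(s))\,B^{d+1}+O(B^d)\qquad (B\ge 1),$$ where the implied constant depends only on $d$ and $s$. Moreover, $\lambda_{d+1}(\mathcal H_d(s))>0$ for all such $d$ and $s$. -/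

import Mathlib

namespace PolySignature

open Polynomial

noncomputable section

/-- The real polynomial `p_d X^d + ... + p_1 X + p_0` with coefficient vector `p`. -/
def toPoly {d : ℕ} (p : Fin (d + 1) → ℝ) : ℝ[X] :=
  ∑ i : Fin (d + 1), C (p i) * X ^ (i : ℕ)

/-- `P` has signature `s`: it has exactly `s` pairs of complex conjugate non-real roots,
i.e. exactly `2 * s` non-real complex roots, counted with multiplicity. -/
def HasSignature (P : ℝ[X]) (s : ℕ) : Prop :=
  (P.aroots ℂ).countP (fun z : ℂ => z.im ≠ 0) = 2 * s

/-- The set of real coefficient vectors `(p_0, ..., p_d)` with `p_d ≠ 0` and `|p_i| ≤ B`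
whose polynomial (of degree `d`) has signature `s`. -/
def coeffSet (d s : ℕ) (B : ℝ) : Set (Fin (d + 1) → ℝ) :=
  {p | p (Fin.last d) ≠ 0 ∧ (∀ i, |p i| ≤ B) ∧ HasSignature (toPoly p) s}

/-- The set of integer polynomials of degree exactly `d`, all of whose coefficients have
absolute value at most `B`, with signature `s`. -/
def intPolySet (d s : ℕ) (B : ℝ) : Set ℤ[X] :=
  {f | f.degree = (d : WithBot ℕ) ∧ (∀ i ≤ d, |(f.coeff i : ℝ)| ≤ B) ∧
    HasSignature (f.map (Int.castRingHom ℝ)) s}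

/-- The number of integer polynomials of degree `d` and signature `s` whose coefficients
are bounded in absolute value by `B`. -/
def intPolyCount (d s : ℕ) (B : ℝ) : ℕ :=
  (intPolySet d s B).ncard

end

end PolySignature

/-!
A polynomial of degree `d` has signature `s` iff it has `d - 2 * s` real roots. Roots depend
continuously on the coefficients as long as the degree is fixed, so the number of real roots can
only drop under a small perturbation, and it is locally constant away from the polynomials with a
multiple real root. Upper semicontinuity makes `coeffSet d s B` a Borel set.

Let `t` vary in `P + t X ^ i`, where `P` has no term of degree `i`. A multiple root `x` of this
polynomial is also a root of `X * derivative P - i * P`, in which `t` does not occur, and `x ≠ 0`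
determines `t`; the multiplicity of the root `0` does not change as long as `t ≠ 0`. Hence on each
line parallel to a coordinate axis, membership in `coeffSet d s B` changes at no more than `d + 3`
points. As in Davenport's lattice point estimate, rounding down the coordinates one at a time then
changes the volume by `O(B ^ d)` each time and turns it into the number of integer points. The main
term comes from `coeffSet d s B = B • coeffSet d s 1`, and its constant is positive because a
polynomial of signature `s` with simple real roots has a neighbourhood of polynomials of signature
`s`.
-/

namespace PolySignature

open Polynomial Filter Topology MeasureTheory Finset

section RealRoots

theorem filter_im_eq_zero_aroots (P : ℝ[X]) :
    (P.aroots ℂ).filter (fun z => z.im = 0) = P.roots.map (algebraMap ℝ ℂ) := by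
  have hinj := (algebraMap ℝ ℂ).injective
  ext z
  by_cases hz : z.im = 0
  · obtain ⟨x, rfl⟩ : ∃ x : ℝ, algebraMap ℝ ℂ x = z := ⟨z.re, Complex.ext rfl hz.symm⟩
    rw [Multiset.count_filter, if_pos hz, Multiset.count_map_eq_count' _ _ hinj, aroots_def,
      count_roots, count_roots, eq_rootMultiplicity_map hinj]
  · rw [Multiset.count_filter, if_neg hz, eq_comm, Multiset.count_eq_zero, Multiset.mem_map]
    rintro ⟨x, -, rfl⟩
    exact hz (Complex.ofReal_im x)

theorem card_roots_eq_countP_aroots (P : ℝ[X]) :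
    P.roots.card = (P.aroots ℂ).countP (fun z => z.im = 0) := by
  rw [Multiset.countP_eq_card_filter, filter_im_eq_zero_aroots, Multiset.card_map]

theorem hasSignature_iff_card_roots {P : ℝ[X]} {s : ℕ} :
    HasSignature P s ↔ P.roots.card + 2 * s = P.natDegree := by
  have hsplit := Multiset.card_eq_countP_add_countP (fun z : ℂ => z.im = 0) (P.aroots ℂ)
  rw [IsAlgClosed.card_aroots_eq_natDegree, ← card_roots_eq_countP_aroots] at hsplit
  rw [HasSignature, hsplit, Nat.add_left_cancel_iff, eq_comm]

theorem rootMultiplicity_eq_count_aroots (P : ℝ[X]) (x : ℝ) :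
    P.rootMultiplicity x = (P.aroots ℂ).count (x : ℂ) := by
  rw [aroots_def, count_roots, eq_rootMultiplicity_map (algebraMap ℝ ℂ).injective]
  rfl

end RealRoots

section ContinuityOfRoots

variable {ι : Type*}

/-- Convergence, coefficient by coefficient, of a family of polynomials which eventually have the
same degree as the limit, so that no root escapes to infinity. -/
structure TendstoFixedDegree {R : Type*} [Semiring R] [TopologicalSpace R]
    (P : ι → R[X]) (l : Filter ι) (P₀ : R[X]) : Prop where
  eventually_natDegree_eq : ∀ᶠ i in l, (P i).natDegree = P₀.natDegree
  tendsto_coeff : ∀ n, Tendsto (fun i => (P i).coeff n) l (𝓝 (P₀.coeff n))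

namespace TendstoFixedDegree

section Semiring

variable {R : Type*} [Semiring R] [TopologicalSpace R] {P : ι → R[X]} {l l' : Filter ι} {P₀ : R[X]}

theorem mono_left (h : TendstoFixedDegree P l P₀) (hl : l' ≤ l) : TendstoFixedDegree P l' P₀ :=
  ⟨h.eventually_natDegree_eq.filter_mono hl, fun n => (h.tendsto_coeff n).mono_left hl⟩

theorem tendsto_leadingCoeff (h : TendstoFixedDegree P l P₀) :
    Tendsto (fun i => (P i).leadingCoeff) l (𝓝 P₀.leadingCoeff) := by
  refine (h.tendsto_coeff P₀.natDegree).congr' ?_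
  filter_upwards [h.eventually_natDegree_eq] with i hi
  rw [leadingCoeff, hi]

theorem eventually_ne_zero [T1Space R] (h : TendstoFixedDegree P l P₀) (h₀ : P₀ ≠ 0) :
    ∀ᶠ i in l, P i ≠ 0 :=
  (h.tendsto_leadingCoeff.eventually_ne (leadingCoeff_ne_zero.2 h₀)).mono
    fun _ => leadingCoeff_ne_zero.1

theorem tendsto_eval [IsTopologicalSemiring R] (h : TendstoFixedDegree P l P₀) (x : R) :
    Tendsto (fun i => (P i).eval x) l (𝓝 (P₀.eval x)) := by
  have hsum : Tendsto (fun i => ∑ n ∈ range (P₀.natDegree + 1), (P i).coeff n * x ^ n) l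
      (𝓝 (P₀.eval x)) := by
    rw [eval_eq_sum_range]
    exact tendsto_finsetSum _ fun n _ => (h.tendsto_coeff n).mul_const _
  refine hsum.congr' ?_
  filter_upwards [h.eventually_natDegree_eq] with i hi
  rw [eval_eq_sum_range, hi]

end Semiring

theorem map {K L : Type*} [DivisionRing K] [TopologicalSpace K] [Semiring L] [Nontrivial L]
    [TopologicalSpace L] {P : ι → K[X]} {l : Filter ι} {P₀ : K[X]}
    (h : TendstoFixedDegree P l P₀) {f : K →+* L} (hf : Continuous f) :
    TendstoFixedDegree (fun i => (P i).map f) l (P₀.map f) where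
  eventually_natDegree_eq := by simpa only [natDegree_map] using h.eventually_natDegree_eq
  tendsto_coeff n := by
    simpa only [coeff_map, Function.comp_def] using (hf.tendsto _).comp (h.tendsto_coeff n)

section NormedField

variable {K : Type*} [NormedField K] {P : ι → K[X]} {l : Filter ι} {P₀ : K[X]}

theorem tendsto_cauchyBound (h : TendstoFixedDegree P l P₀) (h₀ : P₀ ≠ 0) :
    Tendsto (fun i => (P i).cauchyBound) l (𝓝 P₀.cauchyBound) := by
  have hsup : Tendsto (fun i => (range P₀.natDegree).sup (fun n => ‖(P i).coeff n‖₊)) l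
      (𝓝 ((range P₀.natDegree).sup (fun n => ‖P₀.coeff n‖₊))) :=
    Tendsto.finset_sup_nhds_apply fun n _ => (h.tendsto_coeff n).nnnorm
  refine ((hsup.div h.tendsto_leadingCoeff.nnnorm
    (nnnorm_ne_zero_iff.2 (leadingCoeff_ne_zero.2 h₀))).add_const 1).congr' ?_
  filter_upwards [h.eventually_natDegree_eq] with i hi
  rw [cauchyBound, hi]
  rfl

theorem exists_eventually_norm_le_of_mem_roots (h : TendstoFixedDegree P l P₀) (h₀ : P₀ ≠ 0) :
    ∃ R : ℝ, ∀ᶠ i in l, ∀ x ∈ (P i).roots, ‖x‖ ≤ R := by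
  refine ⟨(P₀.cauchyBound + 1 : NNReal), ?_⟩
  filter_upwards [(h.tendsto_cauchyBound h₀).eventually_lt_const (lt_add_one _),
    h.eventually_ne_zero h₀] with i hi hPi x hx
  exact NNReal.coe_le_coe.2 (((isRoot_of_mem_roots hx).norm_lt_cauchyBound hPi).trans hi).le

theorem roots_eq_of_tendsto [Infinite K] {κ : Type*} [Fintype κ] [l.NeBot]
    (h : TendstoFixedDegree P l P₀) (h₀ : P₀ ≠ 0) (hP : ∀ i, (P i).Splits)
    {z : ι → κ → K} {w : κ → K} (hz : ∀ᶠ i in l, univ.val.map (z i) = (P i).roots)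
    (hw : ∀ j, Tendsto (fun i => z i j) l (𝓝 (w j))) :
    univ.val.map w = P₀.roots := by
  have heval : ∀ x, P₀.eval x = P₀.leadingCoeff * ∏ j, (x - w j) := by
    intro x
    have hprod : Tendsto (fun i => (P i).leadingCoeff * ∏ j, (x - z i j)) l
        (𝓝 (P₀.leadingCoeff * ∏ j, (x - w j))) :=
      h.tendsto_leadingCoeff.mul (tendsto_finsetProd _ fun j _ => (hw j).const_sub x)
    refine tendsto_nhds_unique (h.tendsto_eval x) (hprod.congr' ?_)
    filter_upwards [hz] with i hi
    rw [(hP i).eval_eq_prod_roots, ← hi, Multiset.map_map]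
    rfl
  have hfactor : P₀ = C P₀.leadingCoeff * ((univ.val.map w).map fun a => X - C a).prod := by
    refine Polynomial.funext fun x => ?_
    rw [heval x, eval_mul, eval_C, Multiset.map_map, eval_multiset_prod, Multiset.map_map]
    simp
  rw [hfactor, roots_C_mul _ (leadingCoeff_ne_zero.2 h₀), roots_multiset_prod_X_sub_C]

end NormedField

end TendstoFixedDegree

theorem exists_map_univ_eq_of_card_eq {α : Type*} {m : Multiset α} {n : ℕ} (hm : m.card = n) :
    ∃ z : Fin n → α, univ.val.map z = m := by
  obtain ⟨L, rfl⟩ := Quot.exists_rep m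
  obtain rfl : L.length = n := hm
  exact ⟨L.get, by rw [Fin.univ_val_map, List.ofFn_get]; rfl⟩

theorem TendstoFixedDegree.exists_tendsto_roots {K : Type*} [NormedField K] [Infinite K]
    [ProperSpace K] {P : ι → K[X]} {U : Ultrafilter ι} {P₀ : K[X]}
    (h : TendstoFixedDegree P U P₀) (h₀ : P₀ ≠ 0) (hP : ∀ i, (P i).Splits) :
    ∃ (n : ℕ) (z : ι → Fin n → K) (w : Fin n → K),
      (∀ᶠ i in (U : Filter ι), univ.val.map (z i) = (P i).roots) ∧
        univ.val.map w = P₀.roots ∧ ∀ j, Tendsto (fun i => z i j) U (𝓝 (w j)) := by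
  have hlabel : ∀ i, ∃ z : Fin P₀.natDegree → K, (P i).natDegree = P₀.natDegree →
      univ.val.map z = (P i).roots := fun i =>
    if hi : (P i).natDegree = P₀.natDegree then
      (exists_map_univ_eq_of_card_eq ((hP i).natDegree_eq_card_roots.symm.trans hi)).imp
        fun _ hz _ => hz
    else ⟨0, fun hi' => absurd hi' hi⟩
  choose z hz using hlabel
  have hz' : ∀ᶠ i in (U : Filter ι), univ.val.map (z i) = (P i).roots :=
    h.eventually_natDegree_eq.mono hz
  obtain ⟨R, hR⟩ := h.exists_eventually_norm_le_of_mem_roots h₀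
  have hlim : ∀ j, ∃ a, Tendsto (fun i => z i j) U (𝓝 a) := by
    intro j
    have hball : ∀ᶠ i in (U : Filter ι), z i j ∈ Metric.closedBall 0 R := by
      filter_upwards [hR, hz'] with i hRi hzi
      exact mem_closedBall_zero_iff.2 (hRi _ (hzi ▸ Multiset.mem_map_of_mem _ (mem_univ j)))
    obtain ⟨a, -, ha⟩ :=
      (isCompact_closedBall (0 : K) R).ultrafilter_le_nhds' (U.map fun i => z i j) hball
    exact ⟨a, ha⟩
  choose w hw using hlim
  exact ⟨_, z, w, hz', h.roots_eq_of_tendsto h₀ hP hz' hw, hw⟩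

theorem TendstoFixedDegree.exists_tendsto_aroots {P : ι → ℝ[X]} {U : Ultrafilter ι} {P₀ : ℝ[X]}
    (h : TendstoFixedDegree P U P₀) (h₀ : P₀ ≠ 0) :
    ∃ (n : ℕ) (z : ι → Fin n → ℂ) (w : Fin n → ℂ),
      (∀ᶠ i in (U : Filter ι), univ.val.map (z i) = (P i).aroots ℂ) ∧
        univ.val.map w = P₀.aroots ℂ ∧ ∀ j, Tendsto (fun i => z i j) U (𝓝 (w j)) :=
  (h.map (f := algebraMap ℝ ℂ) Complex.continuous_ofReal).exists_tendsto_roots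
    (map_ne_zero h₀) fun _ => IsAlgClosed.splits _

end ContinuityOfRoots

section RealRootsOfLimit

variable {ι κ : Type*} {l : Filter ι}

theorem eventually_im_eq_zero_of_conj [Finite κ] {z : ι → κ → ℂ} {w : κ → ℂ}
    (hw : ∀ j, Tendsto (fun i => z i j) l (𝓝 (w j)))
    (hconj : ∀ᶠ i in l, ∀ j, ∃ k, z i k = (starRingEnd ℂ) (z i j))
    {j : κ} (hj : (w j).im = 0) (hsimple : ∀ k, w k = w j → k = j) :
    ∀ᶠ i in l, (z i j).im = 0 := by
  have hlim : Tendsto (fun i => (starRingEnd ℂ) (z i j)) l (𝓝 (w j)) := by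
    simpa only [Complex.conj_eq_iff_im.2 hj, Function.comp_def] using
      (Complex.continuous_conj.tendsto _).comp (hw j)
  have hne : ∀ᶠ i in l, ∀ k, k ≠ j → z i k ≠ (starRingEnd ℂ) (z i j) := by
    refine eventually_all.2 fun k => ?_
    by_cases hk : k = j
    · simp [hk]
    · have hsub := ((hw k).sub hlim).eventually_ne (sub_ne_zero.2 (mt (hsimple k) hk))
      exact hsub.mono fun i hi _ => sub_ne_zero.1 hi
  filter_upwards [hconj, hne] with i hi hnei
  obtain ⟨k, hk⟩ := hi j
  obtain rfl : k = j := by_contra fun hkj => hnei k hkj hk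
  exact Complex.conj_eq_iff_im.1 hk.symm

variable [Fintype κ]

theorem eventually_eq_of_card_filter_eq_le {X : Type*} [TopologicalSpace X] [T1Space X]
    [DecidableEq X] {z : ι → κ → X} {w : κ → X} (hw : ∀ j, Tendsto (fun i => z i j) l (𝓝 (w j)))
    {x : X} (hcard : ∀ᶠ i in l, #{j | w j = x} ≤ #{j | z i j = x}) :
    ∀ᶠ i in l, ∀ j, w j = x → z i j = x := by
  have hsub : ∀ᶠ i in l, ∀ j, z i j = x → w j = x := by
    refine eventually_all.2 fun j => ?_
    by_cases hj : w j = x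
    · simp [hj]
    · exact ((hw j).eventually_ne hj).mono fun i hi hi' => absurd hi' hi
  filter_upwards [hcard, hsub] with i hi hsubi j hj
  have heq := eq_of_subset_of_card_le (monotone_filter_right univ fun j _ => hsubi j) hi
  have hmem : j ∈ ({j | z i j = x} : Finset κ) := heq.symm ▸ mem_filter.2 ⟨mem_univ j, hj⟩
  exact (mem_filter.1 hmem).2

theorem card_roots_eq_card_filter {P : ℝ[X]} {z : κ → ℂ} (hz : univ.val.map z = P.aroots ℂ) :
    P.roots.card = #{j | (z j).im = 0} := by
  rw [card_roots_eq_countP_aroots, ← hz, Multiset.countP_map]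
  rfl

theorem rootMultiplicity_eq_card_filter {P : ℝ[X]} {z : κ → ℂ}
    (hz : univ.val.map z = P.aroots ℂ) (x : ℝ) : P.rootMultiplicity x = #{j | z j = x} := by
  rw [rootMultiplicity_eq_count_aroots, ← hz, Multiset.count_map]
  simp only [eq_comm]
  rfl

theorem exists_eq_conj_of_map_eq_aroots {P : ℝ[X]} {z : κ → ℂ}
    (hz : univ.val.map z = P.aroots ℂ) (j : κ) : ∃ k, z k = (starRingEnd ℂ) (z j) := by
  have hj : z j ∈ P.aroots ℂ := hz ▸ Multiset.mem_map_of_mem z (mem_univ j)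
  have hconj : (starRingEnd ℂ) (z j) ∈ P.aroots ℂ := by
    rw [mem_aroots] at hj ⊢
    exact ⟨hj.1, by rw [aeval_conj, hj.2, map_zero]⟩
  obtain ⟨k, -, hk⟩ := Multiset.mem_map.1 (hz ▸ hconj)
  exact ⟨k, hk⟩

theorem TendstoFixedDegree.eventually_card_roots_le {P : ι → ℝ[X]} {P₀ : ℝ[X]}
    (h : TendstoFixedDegree P l P₀) (h₀ : P₀ ≠ 0) :
    ∀ᶠ i in l, (P i).roots.card ≤ P₀.roots.card := by
  refine mem_iff_ultrafilter.2 fun U hU => ?_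
  obtain ⟨n, z, w, hz, hw, hlim⟩ := (h.mono_left hU).exists_tendsto_aroots h₀
  have him : ∀ᶠ i in (U : Filter ι), ∀ j, (z i j).im = 0 → (w j).im = 0 := by
    refine eventually_all.2 fun j => ?_
    by_cases hj : (w j).im = 0
    · simp [hj]
    · have hne := ((Complex.continuous_im.tendsto _).comp (hlim j)).eventually_ne hj
      exact hne.mono fun i hi hi' => absurd hi' hi
  filter_upwards [hz, him] with i hzi himi
  rw [card_roots_eq_card_filter hw, card_roots_eq_card_filter hzi]
  exact card_le_card (monotone_filter_right univ fun j _ => himi j)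

theorem TendstoFixedDegree.eventually_le_card_roots {P : ι → ℝ[X]} {P₀ : ℝ[X]}
    (h : TendstoFixedDegree P l P₀) (h₀ : P₀ ≠ 0)
    (hmult : ∀ x, 1 < P₀.rootMultiplicity x →
      ∀ᶠ i in l, P₀.rootMultiplicity x ≤ (P i).rootMultiplicity x) :
    ∀ᶠ i in l, P₀.roots.card ≤ (P i).roots.card := by
  refine mem_iff_ultrafilter.2 fun U hU => ?_
  obtain ⟨n, z, w, hz, hw, hlim⟩ := (h.mono_left hU).exists_tendsto_aroots h₀
  have hreal : ∀ᶠ i in (U : Filter ι), ∀ j, (w j).im = 0 → (z i j).im = 0 := by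
    refine eventually_all.2 fun j => eventually_imp_distrib_left.2 fun hj => ?_
    obtain ⟨x, hx⟩ : ∃ x : ℝ, w j = x := ⟨(w j).re, Complex.ext rfl hj⟩
    rcases lt_or_ge 1 (P₀.rootMultiplicity x) with hmultiple | hsimple
    · have hcard : ∀ᶠ i in (U : Filter ι), #{j | w j = x} ≤ #{j | z i j = x} := by
        filter_upwards [hz, hU (hmult x hmultiple)] with i hzi hi
        rwa [← rootMultiplicity_eq_card_filter hw, ← rootMultiplicity_eq_card_filter hzi]
      filter_upwards [eventually_eq_of_card_filter_eq_le hlim hcard] with i hi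
      rw [hi j hx, Complex.ofReal_im]
    · refine eventually_im_eq_zero_of_conj hlim
        (hz.mono fun i => exists_eq_conj_of_map_eq_aroots) hj fun k hk => ?_
      rw [rootMultiplicity_eq_card_filter hw] at hsimple
      exact card_le_one.1 hsimple k (by simp [hk, hx]) j (by simp [hx])
  filter_upwards [hz, hreal] with i hzi hi
  rw [card_roots_eq_card_filter hw, card_roots_eq_card_filter hzi]
  exact card_le_card (monotone_filter_right univ fun j _ => hi j)

theorem TendstoFixedDegree.eventually_card_roots_eq {P : ι → ℝ[X]} {P₀ : ℝ[X]}
    (h : TendstoFixedDegree P l P₀) (h₀ : P₀ ≠ 0)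
    (hmult : ∀ x, 1 < P₀.rootMultiplicity x →
      ∀ᶠ i in l, P₀.rootMultiplicity x ≤ (P i).rootMultiplicity x) :
    ∀ᶠ i in l, (P i).roots.card = P₀.roots.card := by
  filter_upwards [h.eventually_card_roots_le h₀, h.eventually_le_card_roots h₀ hmult]
    with i hle hge using hle.antisymm hge

end RealRootsOfLimit

section CoefficientVectors

variable {d : ℕ}

theorem toPoly_eq_ofFn (p : Fin (d + 1) → ℝ) : toPoly p = ofFn (d + 1) p := by
  simp only [toPoly, ofFn_eq_sum_monomial, C_mul_X_pow_eq_monomial]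

theorem coeff_toPoly (p : Fin (d + 1) → ℝ) (i : Fin (d + 1)) : (toPoly p).coeff i = p i := by
  rw [toPoly_eq_ofFn, ofFn_coeff_eq_val_of_lt p i.2]

theorem natDegree_toPoly_le (p : Fin (d + 1) → ℝ) : (toPoly p).natDegree ≤ d := by
  rw [toPoly_eq_ofFn]
  exact Nat.le_of_lt_succ (ofFn_natDegree_lt d.succ_pos p)

theorem natDegree_toPoly {p : Fin (d + 1) → ℝ} (hp : p (Fin.last d) ≠ 0) :
    (toPoly p).natDegree = d :=
  (natDegree_toPoly_le p).antisymm
    (le_natDegree_of_ne_zero ((coeff_toPoly p (Fin.last d)).trans_ne hp))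

theorem toPoly_ne_zero {p : Fin (d + 1) → ℝ} (hp : p (Fin.last d) ≠ 0) : toPoly p ≠ 0 := by
  rw [toPoly_eq_ofFn, ← map_zero (ofFn (d + 1)), (injective_ofFn (d + 1)).ne_iff]
  exact fun h => hp (congrFun h _)

theorem toPoly_coeff_of_natDegree_le {P : ℝ[X]} (hP : P.natDegree ≤ d) :
    toPoly (fun i : Fin (d + 1) => P.coeff i) = P := by
  rw [toPoly_eq_ofFn]
  exact ofFn_comp_toFn_eq_id_of_natDegree_lt (Nat.lt_succ_of_le hP)

theorem toPoly_smul (c : ℝ) (p : Fin (d + 1) → ℝ) : toPoly (c • p) = C c * toPoly p := by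
  rw [toPoly_eq_ofFn, toPoly_eq_ofFn, map_smul, smul_eq_C_mul]

theorem toPoly_update (p : Fin (d + 1) → ℝ) (i : Fin (d + 1)) (t : ℝ) :
    toPoly (Function.update p i t) = toPoly (Function.update p i 0) + C t * X ^ (i : ℕ) := by
  rw [toPoly, toPoly, ← add_sum_erase univ _ (mem_univ i), ← add_sum_erase univ _ (mem_univ i),
    Function.update_self, Function.update_self, C_0, zero_mul, zero_add, add_comm]
  congr 1
  refine sum_congr rfl fun j hj => ?_
  rw [Function.update_of_ne (ne_of_mem_erase hj), Function.update_of_ne (ne_of_mem_erase hj)]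

theorem tendstoFixedDegree_toPoly {q : Fin (d + 1) → ℝ} (hq : q (Fin.last d) ≠ 0) :
    TendstoFixedDegree toPoly (𝓝 q) (toPoly q) where
  eventually_natDegree_eq := by
    filter_upwards [(continuous_apply (Fin.last d)).continuousAt.eventually_ne hq] with p hp
    rw [natDegree_toPoly hp, natDegree_toPoly hq]
  tendsto_coeff n := by
    have hcont : Continuous fun p : Fin (d + 1) → ℝ => (toPoly p).coeff n := by
      simp only [toPoly, finsetSum_coeff, coeff_C_mul]
      fun_prop
    exact hcont.tendsto q

theorem mem_coeffSet_iff {s : ℕ} {B : ℝ} {p : Fin (d + 1) → ℝ} :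
    p ∈ coeffSet d s B ↔
      (p (Fin.last d) ≠ 0 ∧ (toPoly p).roots.card + 2 * s = d) ∧ ∀ i, |p i| ≤ B := by
  rw [coeffSet, Set.mem_ofPred_eq, ← and_assoc, and_right_comm, hasSignature_iff_card_roots]
  refine and_congr_left fun _ => and_congr_right fun hp => ?_
  rw [natDegree_toPoly hp]

theorem isOpen_setOf_card_roots_toPoly_lt (d k : ℕ) :
    IsOpen {p : Fin (d + 1) → ℝ | p (Fin.last d) ≠ 0 ∧ (toPoly p).roots.card < k} := by
  refine isOpen_iff_mem_nhds.2 fun q hq => ?_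
  filter_upwards [(continuous_apply (Fin.last d)).continuousAt.eventually_ne hq.1,
    (tendstoFixedDegree_toPoly hq.1).eventually_card_roots_le (toPoly_ne_zero hq.1)] with p hp hle
  exact ⟨hp, hle.trans_lt hq.2⟩

theorem measurableSet_coeffSet (d s : ℕ) (B : ℝ) : MeasurableSet (coeffSet d s B) := by
  have hbox : MeasurableSet {p : Fin (d + 1) → ℝ | ∀ i, |p i| ≤ B} := by
    simp only [Set.ofPred_forall]
    exact MeasurableSet.iInter fun i => measurableSet_le (by fun_prop) (by fun_prop)
  have heq : coeffSet d s B =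
      ({p | p (Fin.last d) ≠ 0 ∧ (toPoly p).roots.card < d + 1 - 2 * s} \
        {p | p (Fin.last d) ≠ 0 ∧ (toPoly p).roots.card < d - 2 * s}) ∩ {p | ∀ i, |p i| ≤ B} := by
    ext p
    rw [mem_coeffSet_iff]
    refine and_congr_left fun _ => ?_
    simp only [Set.mem_sdiff, Set.mem_ofPred_eq]
    grind
  rw [heq]
  exact ((isOpen_setOf_card_roots_toPoly_lt d _).measurableSet.diff
    (isOpen_setOf_card_roots_toPoly_lt d _).measurableSet).inter hbox

end CoefficientVectors

section Support

theorem natDegree_eq_of_support_eq {R : Type*} [Semiring R] {P Q : R[X]}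
    (h : P.support = Q.support) :
    P.natDegree = Q.natDegree := by
  rw [natDegree, natDegree, degree, degree, h]

theorem rootMultiplicity_zero_eq_of_support_eq {R : Type*} [CommRing R] {P Q : R[X]}
    (h : P.support = Q.support) :
    P.rootMultiplicity 0 = Q.rootMultiplicity 0 := by
  rw [rootMultiplicity_eq_natTrailingDegree', rootMultiplicity_eq_natTrailingDegree',
    natTrailingDegree, natTrailingDegree, trailingDegree, trailingDegree, h]

theorem support_add_C_mul_X_pow {R : Type*} [Semiring R] {P : R[X]} {i : ℕ} {t : R}
    (hi : P.coeff i = 0) (ht : t ≠ 0) :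
    (P + C t * X ^ i).support = insert i P.support := by
  ext n
  rcases eq_or_ne n i with rfl | hn
  · simp [hi, ht]
  · simp [hn]

end Support

section EulerOperator

variable {R : Type*} [CommRing R]

/-- The operator `X d/dX - i`, which annihilates `X ^ i` and so does not see the coefficient of
`X ^ i` in a polynomial. -/
noncomputable def eulerOperator (i : ℕ) (P : R[X]) : R[X] :=
  X * derivative P - C (i : R) * P

theorem coeff_eulerOperator (i : ℕ) (P : R[X]) (n : ℕ) :
    (eulerOperator i P).coeff n = ((n : R) - i) * P.coeff n := by
  rw [eulerOperator, coeff_sub, coeff_C_mul]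
  cases n with
  | zero => simp
  | succ m =>
    rw [coeff_X_mul, coeff_derivative]
    push_cast
    ring

theorem natDegree_eulerOperator_le (i : ℕ) (P : R[X]) :
    (eulerOperator i P).natDegree ≤ P.natDegree :=
  natDegree_le_iff_coeff_eq_zero.2 fun n hn => by
    rw [coeff_eulerOperator, coeff_eq_zero_of_natDegree_lt hn, mul_zero]

theorem eulerOperator_add_C_mul_X_pow (i : ℕ) (P : R[X]) (t : R) :
    eulerOperator i (P + C t * X ^ i) = eulerOperator i P := by
  ext n
  simp only [coeff_eulerOperator, coeff_add, coeff_C_mul_X_pow]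
  split_ifs with h
  · rw [h, sub_self, zero_mul, zero_mul]
  · rw [add_zero]

theorem eulerOperator_ne_zero [IsDomain R] [CharZero R] {i : ℕ} {P : R[X]} (hP : P ≠ 0)
    (hi : P.coeff i = 0) : eulerOperator i P ≠ 0 := by
  obtain ⟨n, hn⟩ : ∃ n, P.coeff n ≠ 0 := ⟨_, leadingCoeff_ne_zero.2 hP⟩
  have hni : (n : R) ≠ i := Nat.cast_injective.ne fun h => hn (h ▸ hi)
  exact fun h => mul_ne_zero (sub_ne_zero.2 hni) hn (by rw [← coeff_eulerOperator, h, coeff_zero])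

theorem isRoot_eulerOperator_of_one_lt_rootMultiplicity (i : ℕ) {P : R[X]} {x : R}
    (h : 1 < P.rootMultiplicity x) : (eulerOperator i P).IsRoot x := by
  have hP : P ≠ 0 := by
    rintro rfl
    simp at h
  obtain ⟨hx, hx'⟩ := (one_lt_rootMultiplicity_iff_isRoot hP).1 h
  rw [IsRoot, eulerOperator, eval_sub, eval_mul, eval_mul, hx.eq_zero, hx'.eq_zero]
  simp

end EulerOperator

section CriticalValues

variable {P : ℝ[X]} {i : ℕ} {t : ℝ}

/-- The finitely many parameters `t` for which `P + t X ^ i`, where `P` has no term of degree `i`,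
may have a nonzero multiple real root. -/
noncomputable def criticalValues (P : ℝ[X]) (i : ℕ) : Finset ℝ :=
  (eulerOperator i P).roots.toFinset.image fun x => -P.eval x / x ^ i

theorem card_criticalValues_le (P : ℝ[X]) (i : ℕ) : #(criticalValues P i) ≤ P.natDegree :=
  calc #(criticalValues P i) ≤ #(eulerOperator i P).roots.toFinset := card_image_le
    _ ≤ (eulerOperator i P).roots.card := Multiset.toFinset_card_le _
    _ ≤ (eulerOperator i P).natDegree := card_roots' _
    _ ≤ P.natDegree := natDegree_eulerOperator_le i P

theorem mem_criticalValues (hi : P.coeff i = 0) (ht : t ≠ 0) {x : ℝ} (hx : x ≠ 0)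
    (h : 1 < (P + C t * X ^ i).rootMultiplicity x) : t ∈ criticalValues P i := by
  have hroot : (P + C t * X ^ i).IsRoot x :=
    (rootMultiplicity_pos'.1 (zero_lt_one.trans h)).2
  have heval : P.eval x + t * x ^ i = 0 := by simpa using hroot
  have hP : P ≠ 0 := by
    rintro rfl
    simp [ht, hx] at heval
  have heuler := isRoot_eulerOperator_of_one_lt_rootMultiplicity i h
  rw [eulerOperator_add_C_mul_X_pow] at heuler
  refine mem_image.2 ⟨x, Multiset.mem_toFinset.2 ?_, ?_⟩
  · exact (mem_roots (eulerOperator_ne_zero hP hi)).2 heuler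
  · rw [div_eq_iff (pow_ne_zero i hx)]
    linarith

theorem tendstoFixedDegree_add_C_mul_X_pow (hi : P.coeff i = 0) (ht : t ≠ 0) :
    TendstoFixedDegree (fun u => P + C u * X ^ i) (𝓝 t) (P + C t * X ^ i) where
  eventually_natDegree_eq := (eventually_ne_nhds ht).mono fun u hu =>
    natDegree_eq_of_support_eq <| by
      rw [support_add_C_mul_X_pow hi hu, support_add_C_mul_X_pow hi ht]
  tendsto_coeff n := by
    have hcont : Continuous fun u : ℝ => (P + C u * X ^ i).coeff n := by
      simp only [coeff_add, coeff_C_mul]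
      fun_prop
    exact hcont.tendsto t

theorem eventually_card_roots_add_C_mul_X_pow_eq (hi : P.coeff i = 0) (ht : t ≠ 0)
    (hcrit : t ∉ criticalValues P i) :
    ∀ᶠ u in 𝓝 t, (P + C u * X ^ i).roots.card = (P + C t * X ^ i).roots.card := by
  have hne : P + C t * X ^ i ≠ 0 := by
    rw [← support_nonempty, support_add_C_mul_X_pow hi ht]
    exact insert_nonempty i _
  refine (tendstoFixedDegree_add_C_mul_X_pow hi ht).eventually_card_roots_eq hne fun x hx => ?_
  obtain rfl : x = 0 := by_contra fun hx₀ => hcrit (mem_criticalValues hi ht hx₀ hx)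
  filter_upwards [eventually_ne_nhds ht] with u hu
  refine (rootMultiplicity_zero_eq_of_support_eq ?_).le
  rw [support_add_C_mul_X_pow hi hu, support_add_C_mul_X_pow hi ht]

theorem card_roots_add_C_mul_X_pow_eq {a b : ℝ} (hi : P.coeff i = 0) (hab : a ≤ b)
    (h : ∀ t ∈ Set.Icc a b, t ∉ insert 0 (criticalValues P i)) :
    (P + C a * X ^ i).roots.card = (P + C b * X ^ i).roots.card := by
  have hcont : ContinuousOn (fun t => (P + C t * X ^ i).roots.card) (Set.Icc a b) := by
    intro t ht
    obtain ⟨ht₀, hcrit⟩ := not_or.1 (mt mem_insert.2 (h t ht))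
    refine ContinuousAt.continuousWithinAt (tendsto_const_nhds.congr' ?_)
    exact (eventually_card_roots_add_C_mul_X_pow_eq hi ht₀ hcrit).mono fun _ => Eq.symm
  exact isPreconnected_Icc.constant hcont (Set.left_mem_Icc.2 hab) (Set.right_mem_Icc.2 hab)

end CriticalValues

section Breaks

/-- Membership in `T` changes at no more than `m` points of the line. -/
def HasBreaksLE (T : Set ℝ) (m : ℕ) : Prop :=
  ∃ F : Finset ℝ, #F ≤ m ∧ ∀ a b, a ≤ b → (∀ t ∈ Set.Icc a b, t ∉ F) → (a ∈ T ↔ b ∈ T)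

theorem hasBreaksLE_const (c : Prop) : HasBreaksLE {_t | c} 0 :=
  ⟨∅, card_empty.le, fun _ _ _ _ => Iff.rfl⟩

theorem hasBreaksLE_Icc (a b : ℝ) : HasBreaksLE (Set.Icc a b) 2 := by
  refine ⟨{a, b}, card_le_two, fun u v huv h => ?_⟩
  have ha : ¬(u ≤ a ∧ a ≤ v) := fun hmem => h a hmem (by simp)
  have hb : ¬(u ≤ b ∧ b ≤ v) := fun hmem => h b hmem (by simp)
  grind

theorem HasBreaksLE.inter {T T' : Set ℝ} {m m' : ℕ} (h : HasBreaksLE T m)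
    (h' : HasBreaksLE T' m') : HasBreaksLE (T ∩ T') (m + m') := by
  obtain ⟨F, hcard, hF⟩ := h
  obtain ⟨F', hcard', hF'⟩ := h'
  refine ⟨F ∪ F', (card_union_le F F').trans (add_le_add hcard hcard'), fun a b hab hmem => ?_⟩
  exact and_congr (hF a b hab fun t ht => mt (mem_union_left F') (hmem t ht))
    (hF' a b hab fun t ht => mt (mem_union_right F) (hmem t ht))

variable {d : ℕ}

theorem hasBreaksLE_card_roots_update (k : ℕ) (p : Fin (d + 1) → ℝ) (i : Fin (d + 1)) :
    HasBreaksLE {t | Function.update p i t (Fin.last d) ≠ 0 ∧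
      (toPoly (Function.update p i t)).roots.card + k = d} (d + 1) := by
  set P := toPoly (Function.update p i 0) with hP
  have hi : P.coeff i = 0 := by rw [hP, coeff_toPoly, Function.update_self]
  refine ⟨insert 0 (criticalValues P i), ?_, fun a b hab h => ?_⟩
  · exact (card_insert_le _ _).trans (Nat.succ_le_succ
      ((card_criticalValues_le P i).trans (natDegree_toPoly_le _)))
  · have ha₀ : a ≠ 0 := fun h₀ => h a (Set.left_mem_Icc.2 hab) (h₀ ▸ mem_insert_self _ _)
    have hb₀ : b ≠ 0 := fun h₀ => h b (Set.right_mem_Icc.2 hab) (h₀ ▸ mem_insert_self _ _)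
    have hlead : Function.update p i a (Fin.last d) ≠ 0 ↔
        Function.update p i b (Fin.last d) ≠ 0 := by
      simp only [Function.update_apply]
      split_ifs
      · exact iff_of_true ha₀ hb₀
      · exact Iff.rfl
    simp only [Set.mem_ofPred_eq, hlead, toPoly_update p i a, toPoly_update p i b, ← hP,
      card_roots_add_C_mul_X_pow_eq hi hab h]

theorem hasBreaksLE_coeffSet_update (s : ℕ) (B : ℝ) (p : Fin (d + 1) → ℝ) (i : Fin (d + 1)) :
    HasBreaksLE {t | Function.update p i t ∈ coeffSet d s B} (d + 3) := by
  have heq : {t | Function.update p i t ∈ coeffSet d s B} =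
      {t | Function.update p i t (Fin.last d) ≠ 0 ∧
        (toPoly (Function.update p i t)).roots.card + 2 * s = d} ∩
      (Set.Icc (-B) B ∩ {_t | ∀ j ≠ i, |p j| ≤ B}) := by
    ext t
    rw [Set.mem_ofPred_eq, mem_coeffSet_iff,
      Function.forall_update_iff p (p := fun _ y => |y| ≤ B), abs_le]
    rfl
  rw [heq]
  exact (hasBreaksLE_card_roots_update (2 * s) p i).inter
    ((hasBreaksLE_Icc (-B) B).inter (hasBreaksLE_const _))

end Breaks

section Cavalieri

variable {ι : Type*} [Fintype ι] [DecidableEq ι]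

theorem lintegral_pi_mono_of_update {X : ι → Type*} [∀ i, MeasurableSpace (X i)]
    {μ : ∀ i, Measure (X i)} [∀ i, SigmaFinite (μ i)] (k : ι) {f g : (∀ i, X i) → ENNReal}
    (hf : Measurable f) (hg : Measurable g)
    (h : ∀ x, ∫⁻ t, f (Function.update x k t) ∂μ k ≤ ∫⁻ t, g (Function.update x k t) ∂μ k) :
    ∫⁻ x, f x ∂Measure.pi μ ≤ ∫⁻ x, g x ∂Measure.pi μ := by
  rcases isEmpty_or_nonempty (∀ i, X i) with hempty | ⟨⟨x⟩⟩
  · simp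
  rw [lintegral_eq_lmarginal_univ x, lintegral_eq_lmarginal_univ x,
    lmarginal_erase' f hf (mem_univ k), lmarginal_erase' g hg (mem_univ k)]
  exact lmarginal_mono h x

theorem pi_le_mul_pi_of_update_le {X : ι → Type*} [∀ i, MeasurableSpace (X i)]
    {μ : ∀ i, Measure (X i)} [∀ i, SigmaFinite (μ i)] (k : ι) {E G : Set (∀ i, X i)}
    (hE : MeasurableSet E) (hG : MeasurableSet G) {c : ENNReal}
    (h : ∀ x, μ k {t | Function.update x k t ∈ E} ≤ c * μ k {t | Function.update x k t ∈ G}) :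
    Measure.pi μ E ≤ c * Measure.pi μ G := by
  have hfibre : ∀ {H : Set (∀ i, X i)}, MeasurableSet H → ∀ (x : ∀ i, X i) (a : ENNReal),
      ∫⁻ t, H.indicator (fun _ => a) (Function.update x k t) ∂μ k =
        a * μ k {t | Function.update x k t ∈ H} := fun hH x a =>
    lintegral_indicator_const (measurable_update x hH) a
  rw [← one_mul (Measure.pi μ E), ← lintegral_indicator_const hE, ← lintegral_indicator_const hG]
  refine lintegral_pi_mono_of_update k (measurable_const.indicator hE)
    (measurable_const.indicator hG) fun x => ?_
  rw [hfibre hE, hfibre hG, one_mul]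
  exact h x

theorem volume_le_of_volume_update_le (k : ι) {E : Set (ι → ℝ)} (hE : MeasurableSet E) {R : ℝ}
    (hR : ∀ x ∈ E, ∀ i, |x i| ≤ R) {c : ENNReal}
    (hc : ∀ x, volume {t | Function.update x k t ∈ E} ≤ c) :
    volume E ≤ c * ENNReal.ofReal (2 * R) ^ (Fintype.card ι - 1) := by
  set G : Set (ι → ℝ) :=
    Set.univ.pi (Function.update (fun _ => Set.Icc (-R) R) k (Set.Icc 0 1)) with hG
  have hGmeas : MeasurableSet G := by
    refine MeasurableSet.univ_pi fun i => ?_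
    rcases eq_or_ne i k with rfl | hi
    · simp
    · simp [hi]
  have hGvol : volume G = ENNReal.ofReal (2 * R) ^ (Fintype.card ι - 1) := by
    rw [hG, volume_pi_pi, ← mul_prod_erase univ _ (mem_univ k), Function.update_self,
      prod_congr rfl fun i hi => by rw [Function.update_of_ne (ne_of_mem_erase hi)]]
    simp [card_erase_of_mem, two_mul]
  rw [← hGvol]
  refine pi_le_mul_pi_of_update_le k hE hGmeas fun x => ?_
  by_cases hx : ∀ i ≠ k, |x i| ≤ R
  · have hsub : Set.Icc 0 1 ⊆ {t | Function.update x k t ∈ G} := fun t ht i _ => by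
      rcases eq_or_ne i k with rfl | hi
      · simpa using ht
      · simpa [hi] using abs_le.1 (hx i hi)
    calc volume {t | Function.update x k t ∈ E} ≤ c * volume (Set.Icc (0 : ℝ) 1) := by
          simpa using hc x
      _ ≤ c * volume {t | Function.update x k t ∈ G} := by gcongr
  · have hfibre : {t | Function.update x k t ∈ E} = ∅ := by
      refine Set.eq_empty_of_forall_notMem fun t ht => hx fun i hi => ?_
      simpa [hi] using hR _ ht i
    rw [hfibre, measure_empty]
    exact zero_le

end Cavalieri

section LatticePoints

theorem HasBreaksLE.volume_floor_mem_iff_le {T : Set ℝ} {m : ℕ} (h : HasBreaksLE T m) :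
    volume {t : ℝ | ¬((⌊t⌋ : ℝ) ∈ T ↔ t ∈ T)} ≤ m := by
  obtain ⟨F, hcard, hF⟩ := h
  have hsub : {t : ℝ | ¬((⌊t⌋ : ℝ) ∈ T ↔ t ∈ T)} ⊆ ⋃ f ∈ F, Set.Ico (⌊f⌋ : ℝ) (⌊f⌋ + 1) := by
    intro t ht
    obtain ⟨f, hf, hfF⟩ : ∃ f ∈ Set.Icc (⌊t⌋ : ℝ) t, f ∈ F := by
      by_contra! hcon
      exact ht (hF _ _ (Int.floor_le t) hcon)
    have hfloor : ⌊t⌋ = ⌊f⌋ := (Int.le_floor.2 hf.1).antisymm (Int.floor_mono hf.2)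
    exact Set.mem_biUnion hfF (Int.floor_eq_iff.1 hfloor)
  calc volume {t : ℝ | ¬((⌊t⌋ : ℝ) ∈ T ↔ t ∈ T)}
      ≤ ∑ f ∈ F, volume (Set.Ico (⌊f⌋ : ℝ) (⌊f⌋ + 1)) :=
        (measure_mono hsub).trans (measure_biUnion_finset_le _ _)
    _ = #F := by simp
    _ ≤ m := Nat.cast_le.2 hcard

variable {ι : Type*} [DecidableEq ι] {S : Finset ι} {k : ι} {x : ι → ℝ}

/-- The vector `x` with the coordinates in `S` rounded down. It interpolates between `x` and its
integer part, one coordinate at a time. -/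
noncomputable def floorOn (S : Finset ι) (x : ι → ℝ) : ι → ℝ :=
  S.piecewise (fun i => (⌊x i⌋ : ℝ)) x

theorem floorOn_empty : floorOn (∅ : Finset ι) = id :=
  funext fun x => piecewise_empty _ x

theorem floorOn_univ [Fintype ι] (x : ι → ℝ) : floorOn univ x = fun i => (⌊x i⌋ : ℝ) :=
  piecewise_univ _ _

theorem measurable_floorOn (S : Finset ι) : Measurable (floorOn S) := by
  refine measurable_pi_lambda _ fun i => ?_
  by_cases hi : i ∈ S
  · simp only [floorOn, piecewise_eq_of_mem _ _ _ hi]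
    fun_prop
  · simp only [floorOn, piecewise_eq_of_notMem _ _ _ hi]
    fun_prop

theorem floorOn_update (hk : k ∉ S) (t : ℝ) :
    floorOn S (Function.update x k t) = Function.update (floorOn S x) k t := by
  ext i
  rcases eq_or_ne i k with rfl | hi
  · simp [floorOn, hk]
  · simp [floorOn, hi, piecewise]

theorem floorOn_insert_update (hk : k ∉ S) (t : ℝ) :
    floorOn (insert k S) (Function.update x k t) = Function.update (floorOn S x) k ⌊t⌋ := by
  rw [floorOn, piecewise_insert, ← floorOn, floorOn_update hk, Function.update_self,
    Function.update_idem]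

theorem abs_le_of_abs_floorOn_le {i : ι} {B : ℝ} (h : |floorOn S x i| ≤ B) : |x i| ≤ B + 1 := by
  have hlow := Int.floor_le (x i)
  have hupp := Int.lt_floor_add_one (x i)
  by_cases hi : i ∈ S
  · rw [floorOn, piecewise_eq_of_mem _ _ _ hi, abs_le] at h
    exact abs_le.2 ⟨by linarith, by linarith⟩
  · rw [floorOn, piecewise_eq_of_notMem _ _ _ hi] at h
    linarith

variable [Fintype ι] {A : Set (ι → ℝ)} {B : ℝ} {m : ℕ}

theorem volume_symmDiff_floorOn_le (hA : MeasurableSet A) (hB : ∀ x ∈ A, ∀ i, |x i| ≤ B)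
    (hm : ∀ x k, HasBreaksLE {t | Function.update x k t ∈ A} m) (hk : k ∉ S) :
    volume (symmDiff (floorOn S ⁻¹' A) (floorOn (insert k S) ⁻¹' A)) ≤
      m * ENNReal.ofReal (2 * (B + 1)) ^ (Fintype.card ι - 1) := by
  refine volume_le_of_volume_update_le k
    ((measurable_floorOn _ hA).symmDiff (measurable_floorOn _ hA)) ?_ fun x => ?_
  · rintro x (⟨hx, -⟩ | ⟨hx, -⟩) i <;> exact abs_le_of_abs_floorOn_le (hB _ hx i)
  · refine (measure_mono fun t ht => ?_).trans (hm (floorOn S x) k).volume_floor_mem_iff_le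
    simp only [Set.mem_ofPred_eq, Set.mem_symmDiff, Set.mem_preimage, floorOn_update hk,
      floorOn_insert_update hk] at ht ⊢
    tauto

theorem volume_floorOn_preimage_ne_top (hB : ∀ x ∈ A, ∀ i, |x i| ≤ B) (S : Finset ι) :
    volume (floorOn S ⁻¹' A) ≠ ⊤ := by
  have hsub : floorOn S ⁻¹' A ⊆ Set.Icc (fun _ => -(B + 1)) (fun _ => B + 1) := fun x hx =>
    have h := fun i => abs_le.1 (abs_le_of_abs_floorOn_le (hB _ hx i))
    ⟨fun i => (h i).1, fun i => (h i).2⟩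
  exact measure_ne_top_of_subset hsub isCompact_Icc.measure_ne_top

theorem abs_volume_floorOn_sub_le (hA : MeasurableSet A) (hB₀ : 0 ≤ B)
    (hB : ∀ x ∈ A, ∀ i, |x i| ≤ B)
    (hm : ∀ x k, HasBreaksLE {t | Function.update x k t ∈ A} m) (S : Finset ι) :
    |volume.real (floorOn S ⁻¹' A) - volume.real A| ≤
      #S * (m * (2 * (B + 1)) ^ (Fintype.card ι - 1)) := by
  induction S using Finset.induction_on with
  | empty => simp [floorOn_empty]
  | insert k S hk ih =>
    have hstep : |volume.real (floorOn (insert k S) ⁻¹' A) - volume.real (floorOn S ⁻¹' A)| ≤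
        m * (2 * (B + 1)) ^ (Fintype.card ι - 1) := by
      rw [abs_sub_comm]
      refine (abs_measureReal_sub_le_measureReal_symmDiff'
        (measurable_floorOn _ hA).nullMeasurableSet (measurable_floorOn _ hA).nullMeasurableSet
        (volume_floorOn_preimage_ne_top hB _) (volume_floorOn_preimage_ne_top hB _)).trans ?_
      have h := ENNReal.toReal_mono (by finiteness) (volume_symmDiff_floorOn_le hA hB hm hk)
      rwa [ENNReal.toReal_mul, ENNReal.toReal_pow, ENNReal.toReal_ofReal (by positivity),
        ENNReal.toReal_natCast] at h
    rw [card_insert_of_notMem hk, Nat.cast_add_one, add_one_mul, add_comm]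
    exact (abs_sub_le _ _ _).trans (add_le_add hstep ih)

theorem volume_floorOn_univ_preimage (hB : ∀ x ∈ A, ∀ i, |x i| ≤ B) :
    volume.real (floorOn univ ⁻¹' A) = {z : ι → ℤ | (fun i => (z i : ℝ)) ∈ A}.ncard := by
  set Z := {z : ι → ℤ | (fun i => (z i : ℝ)) ∈ A}
  have hfin : Z.Finite := by
    refine (Set.finite_Icc (fun _ => -⌊B⌋) (fun _ => ⌊B⌋)).subset fun z hz => ?_
    have hz' : ∀ i, |z i| ≤ ⌊B⌋ := fun i => Int.le_floor.2 (by
      rw [Int.cast_abs]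
      exact hB _ hz i)
    exact ⟨fun i => (abs_le.1 (hz' i)).1, fun i => (abs_le.1 (hz' i)).2⟩
  have heq : floorOn univ ⁻¹' A =
      ⋃ z ∈ hfin.toFinset, Set.univ.pi fun i => Set.Ico (z i : ℝ) (z i + 1) := by
    ext x
    simp only [Set.mem_preimage, floorOn_univ, Set.mem_iUnion₂, Set.Finite.mem_toFinset,
      Set.mem_univ_pi, exists_prop]
    constructor
    · exact fun hx => ⟨fun i => ⌊x i⌋, hx, fun i => ⟨Int.floor_le _, Int.lt_floor_add_one _⟩⟩
    · rintro ⟨z, hz, h⟩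
      obtain rfl : z = fun i => ⌊x i⌋ := funext fun i => (Int.floor_eq_iff.2 (h i)).symm
      exact hz
  rw [heq, measureReal_def, measure_biUnion_finset, Set.ncard_eq_toFinset_card _ hfin]
  · simp [Real.volume_pi_Ico]
  · intro z _ w _ hzw
    refine Set.disjoint_left.2 fun x hx hx' => hzw (funext fun i => ?_)
    rw [← Int.floor_eq_iff.2 (hx i trivial), ← Int.floor_eq_iff.2 (hx' i trivial)]
  · exact fun z _ => MeasurableSet.univ_pi fun _ => measurableSet_Ico

theorem abs_ncard_sub_volume_le (hA : MeasurableSet A) (hB₀ : 0 ≤ B)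
    (hB : ∀ x ∈ A, ∀ i, |x i| ≤ B)
    (hm : ∀ x k, HasBreaksLE {t | Function.update x k t ∈ A} m) :
    |({z : ι → ℤ | (fun i => (z i : ℝ)) ∈ A}.ncard : ℝ) - volume.real A| ≤
      Fintype.card ι * (m * (2 * (B + 1)) ^ (Fintype.card ι - 1)) := by
  rw [← volume_floorOn_univ_preimage hB]
  exact abs_volume_floorOn_sub_le hA hB₀ hB hm univ

end LatticePoints

section Volume

variable {d : ℕ}

open scoped Pointwise in
theorem coeffSet_eq_smul (d s : ℕ) {B : ℝ} (hB : 0 < B) :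
    coeffSet d s B = B • coeffSet d s 1 := by
  ext p
  rw [Set.mem_smul_set_iff_inv_smul_mem₀ hB.ne', mem_coeffSet_iff, mem_coeffSet_iff, toPoly_smul,
    roots_C_mul _ (inv_ne_zero hB.ne')]
  simp [abs_mul, abs_of_pos hB, hB.ne', inv_mul_le_iff₀ hB]

theorem volume_coeffSet (d s : ℕ) {B : ℝ} (hB : 0 < B) :
    volume (coeffSet d s B) = ENNReal.ofReal (B ^ (d + 1)) * volume (coeffSet d s 1) := by
  rw [coeffSet_eq_smul d s hB, Measure.addHaar_smul, Module.finrank_fin_fun,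
    abs_of_pos (pow_pos hB _)]

theorem coeffSet_mem_nhds {s : ℕ} {B : ℝ} {q : Fin (d + 1) → ℝ} (hq : q (Fin.last d) ≠ 0)
    (hsign : HasSignature (toPoly q) s) (hnodup : (toPoly q).roots.Nodup)
    (hbox : ∀ i, |q i| < B) : coeffSet d s B ∈ 𝓝 q := by
  rw [hasSignature_iff_card_roots, natDegree_toPoly hq] at hsign
  have hroots := (tendstoFixedDegree_toPoly hq).eventually_card_roots_eq (toPoly_ne_zero hq)
    fun x hx => absurd hx (by
      rw [← count_roots, not_lt]
      exact Multiset.nodup_iff_count_le_one.1 hnodup x)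
  have hbox' : ∀ᶠ p in 𝓝 q, ∀ i, |p i| < B := eventually_all.2 fun i =>
    (continuous_apply i).abs.continuousAt.eventually_lt_const (hbox i)
  filter_upwards [hroots, hbox',
    (continuous_apply (Fin.last d)).continuousAt.eventually_ne hq] with p hp hpB hp₀
  exact mem_coeffSet_iff.2 ⟨⟨hp₀, hp ▸ hsign⟩, fun i => (hpB i).le⟩

theorem exists_monic_hasSignature_nodup_roots (s r : ℕ) :
    ∃ P : ℝ[X], P.Monic ∧ P.natDegree = 2 * s + r ∧ HasSignature P s ∧ P.roots.Nodup := by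
  set G : ℝ[X] := (X ^ 2 + 1) ^ s with hG
  set H : ℝ[X] := ∏ k ∈ range r, (X - C (k : ℝ)) with hH
  have hmonic : (X ^ 2 + 1 : ℝ[X]).Monic := monic_X_pow_add_C (1 : ℝ) two_ne_zero
  have hGmonic : G.Monic := hmonic.pow s
  have hHmonic : H.Monic := monic_prod_X_sub_C _ _
  have hGdeg : G.natDegree = 2 * s := by
    rw [hG, natDegree_pow, mul_comm]
    exact congrArg (· * s) (natDegree_X_pow_add_C (n := 2) (r := (1 : ℝ)))
  have hHdeg : H.natDegree = r := by
    rw [hH, natDegree_finsetProd_X_sub_C_eq_card, card_range]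
  have hGroots : G.roots = 0 := Multiset.eq_zero_of_forall_notMem fun x hx => by
    have hx₀ := (isRoot_of_mem_roots hx).eq_zero
    simp only [hG, eval_pow, eval_add, eval_X, eval_one] at hx₀
    have hne : (x ^ 2 + 1) ^ s ≠ 0 := by positivity
    exact hne hx₀
  have hHroots : H.roots = (range r).val.map fun k : ℕ => (k : ℝ) := by
    have hprod : H = (((range r).val.map fun k : ℕ => (k : ℝ)).map fun a => X - C a).prod := by
      rw [hH, Multiset.map_map]
      rfl
    rw [hprod, roots_multiset_prod_X_sub_C]
  have hroots : (G * H).roots = (range r).val.map fun k : ℕ => (k : ℝ) := by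
    rw [roots_mul (mul_ne_zero hGmonic.ne_zero hHmonic.ne_zero), hGroots, hHroots, zero_add]
  refine ⟨G * H, hGmonic.mul hHmonic, ?_, ?_, ?_⟩
  · rw [hGmonic.natDegree_mul hHmonic, hGdeg, hHdeg]
  · rw [hasSignature_iff_card_roots, hroots, hGmonic.natDegree_mul hHmonic, hGdeg, hHdeg,
      Multiset.card_map, card_val, card_range, add_comm]
  · rw [hroots]
    exact (range r).nodup.map Nat.cast_injective

theorem volume_coeffSet_pos {s : ℕ} (hs : s ≤ d / 2) : 0 < volume (coeffSet d s 1) := by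
  obtain ⟨P, hmonic, hdeg, hsign, hnodup⟩ := exists_monic_hasSignature_nodup_roots s (d - 2 * s)
  replace hdeg : P.natDegree = d := by omega
  set q : Fin (d + 1) → ℝ := fun i => P.coeff i
  have hqP : toPoly q = P := toPoly_coeff_of_natDegree_le hdeg.le
  have hlead : q (Fin.last d) = 1 := by
    rw [← hmonic.coeff_natDegree, hdeg]
    rfl
  have hnhds : coeffSet d s (‖q‖ + 1) ∈ 𝓝 q :=
    coeffSet_mem_nhds (by simp [hlead]) (hqP ▸ hsign) (hqP ▸ hnodup)
      fun i => (norm_le_pi_norm q i).trans_lt (lt_add_one _)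
  have hpos := Measure.measure_pos_of_mem_nhds volume hnhds
  rw [volume_coeffSet d s (by positivity)] at hpos
  exact pos_of_mul_pos_right hpos zero_le

end Volume

section Counting

variable {d : ℕ}

theorem map_ofFn_eq_toPoly (z : Fin (d + 1) → ℤ) :
    (ofFn (d + 1) z).map (Int.castRingHom ℝ) = toPoly fun i => (z i : ℝ) := by
  simp only [toPoly, ofFn_eq_sum_monomial, Polynomial.map_sum, map_monomial,
    C_mul_X_pow_eq_monomial, eq_intCast]

theorem degree_ofFn_eq_iff {R : Type*} [Semiring R] [DecidableEq R] {v : Fin (d + 1) → R} :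
    (ofFn (d + 1) v).degree = d ↔ v (Fin.last d) ≠ 0 := by
  have hcoeff : (ofFn (d + 1) v).coeff d = v (Fin.last d) :=
    ofFn_coeff_eq_val_of_lt v d.lt_succ_self
  have hle : (ofFn (d + 1) v).degree ≤ d :=
    natDegree_le_iff_degree_le.1 (Nat.le_of_lt_succ (ofFn_natDegree_lt d.succ_pos v))
  rw [← hcoeff]
  exact ⟨coeff_ne_zero_of_eq_degree, degree_eq_of_le_of_coeff_ne_zero hle⟩

theorem ofFn_mem_intPolySet_iff {s : ℕ} {B : ℝ} {z : Fin (d + 1) → ℤ} :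
    ofFn (d + 1) z ∈ intPolySet d s B ↔ (fun i => (z i : ℝ)) ∈ coeffSet d s B := by
  have hbound : (∀ i ≤ d, |((ofFn (d + 1) z).coeff i : ℝ)| ≤ B) ↔ ∀ i, |(z i : ℝ)| ≤ B := by
    simp only [← Nat.lt_succ_iff, Fin.forall_iff]
    exact forall₂_congr fun i hi => by rw [ofFn_coeff_eq_val_of_lt z hi]
  rw [intPolySet, coeffSet, Set.mem_ofPred_eq, Set.mem_ofPred_eq, degree_ofFn_eq_iff, hbound,
    map_ofFn_eq_toPoly, Int.cast_ne_zero]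

theorem intPolyCount_eq_ncard (d s : ℕ) (B : ℝ) :
    intPolyCount d s B = {z : Fin (d + 1) → ℤ | (fun i => (z i : ℝ)) ∈ coeffSet d s B}.ncard := by
  have himage : ofFn (d + 1) '' {z : Fin (d + 1) → ℤ | (fun i => (z i : ℝ)) ∈ coeffSet d s B} =
      intPolySet d s B := by
    ext f
    constructor
    · rintro ⟨z, hz, rfl⟩
      exact ofFn_mem_intPolySet_iff.2 hz
    · intro hf
      have hof : ofFn (d + 1) (toFn (d + 1) f) = f := ofFn_comp_toFn_eq_id_of_natDegree_lt
        (Nat.lt_succ_of_le (natDegree_eq_of_degree_eq_some hf.1).le)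
      exact ⟨toFn (d + 1) f, ofFn_mem_intPolySet_iff.1 (hof.symm ▸ hf), hof⟩
  rw [intPolyCount, ← himage, Set.ncard_image_of_injective _ (injective_ofFn (d + 1))]

theorem abs_intPolyCount_sub_le (d s : ℕ) {B : ℝ} (hB : 1 ≤ B) :
    |(intPolyCount d s B : ℝ) - volume.real (coeffSet d s 1) * B ^ (d + 1)| ≤
      ((d + 1) * ((d + 3) * 4 ^ d)) * B ^ d := by
  have hvol : volume.real (coeffSet d s B) = volume.real (coeffSet d s 1) * B ^ (d + 1) := by
    rw [measureReal_def, volume_coeffSet d s (by positivity), ENNReal.toReal_mul,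
      ENNReal.toReal_ofReal (by positivity), mul_comm, measureReal_def]
  rw [intPolyCount_eq_ncard, ← hvol]
  calc _ ≤ (Fintype.card (Fin (d + 1)) : ℝ) *
        ((d + 3 : ℕ) * (2 * (B + 1)) ^ (Fintype.card (Fin (d + 1)) - 1)) :=
        abs_ncard_sub_volume_le (measurableSet_coeffSet d s B) (by positivity)
          (fun p hp => hp.2.1) (hasBreaksLE_coeffSet_update s B)
    _ = (d + 1) * ((d + 3) * (2 * (B + 1)) ^ d) := by simp
    _ ≤ (d + 1) * ((d + 3) * (4 * B) ^ d) := by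
        have hle : 2 * (B + 1) ≤ 4 * B := by linarith
        gcongr
    _ = ((d + 1) * ((d + 3) * 4 ^ d)) * B ^ d := by ring

end Counting

end PolySignature

theorem theorem1 (d s : ℕ) (hd : 1 ≤ d) (hs : s ≤ d / 2) :
    MeasureTheory.NullMeasurableSet (PolySignature.coeffSet d s 1) MeasureTheory.volume ∧
    (∃ K : ℝ, ∀ B : ℝ, 1 ≤ B →
      |(PolySignature.intPolyCount d s B : ℝ) -
        (MeasureTheory.volume (PolySignature.coeffSet d s 1)).toReal * B ^ (d + 1)|
        ≤ K * B ^ d) ∧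
    0 < MeasureTheory.volume (PolySignature.coeffSet d s 1) :=
  ⟨(PolySignature.measurableSet_coeffSet d s 1).nullMeasurableSet,
    ⟨_, fun _ hB => PolySignature.abs_intPolyCount_sub_le d s hB⟩,
    PolySignature.volume_coeffSet_pos hs⟩
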